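/- Let $d\ge 2$ and let $H^2(\mathbb{D}^d)$ be the Hardy space over the polydisk, that is, the Hilbert space of holomorphic functions $f(z)=\sum_{\alpha\in\mathbb{N}^d}a_\alpha z^\alpha$ on $\mathbb{D}^d$ with $\|f\|^2=\sum_\alpha|a_\alpha|^2<\infty$. For $1\le j\le d$ let $M_{z_j}$ be the operator of multiplication by the coordinate function $z_j$ on $H^2(\mathbb{D}^d)$. Let $\mathcal{M}\subset H^2(\mathbb{D}^d)$ be a nonzero submodule, that is, a nonzero closed subspace with $M_{z_j}\mathcal{M}\subset\mathcal{M}$ for all $j$, and let $J_{z_j}=P_{\mathcal{M}}M_{z_j}|_{\mathcal{M}^\perp}:\mathcal{M}^\perp\to\mathcal{M}$ $(1\le j\le d)$ be its jumping operators, where $P_{\mathcal{M}}$ is the orthogonal projection onto $\mathcal{M}$. Then $\mathcal{M}$ is of infinite codimension in $H^2(\mathbb{D}^d)$ if and only if \[ \operatorname{rank}(J_{z_1})+\cdots+\operatorname{rank}(J_{z_d})=\infty . \] -/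

import Mathlib

open scoped ENNReal InnerProductSpace ComplexConjugate

noncomputable section

/-- The open unit polydisk `𝔻^d` in `ℂ^d`. -/
def polydisk (d : ℕ) : Set (Fin d → ℂ) := {z | ∀ i, ‖z i‖ < 1}

/-- The Hardy space `H²(𝔻^d)`: the holomorphic functions `f z = ∑ α, a α * z ^ α` on the polydisk
whose family of Taylor coefficients is square summable, with
`⟪f, g⟫ = ∑ α, conj (a α) * b α`. An element is stored as its family of Taylor coefficients; the
`RKHS` instance below makes it a function on the polydisk. -/
def HardySpace (d : ℕ) : Type := lp (fun _ : Fin d → ℕ => ℂ) 2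

namespace HardySpace

variable {d : ℕ}

instance : NormedAddCommGroup (HardySpace d) :=
  inferInstanceAs (NormedAddCommGroup (lp (fun _ : Fin d → ℕ => ℂ) 2))

instance : InnerProductSpace ℂ (HardySpace d) :=
  inferInstanceAs (InnerProductSpace ℂ (lp (fun _ : Fin d → ℕ => ℂ) 2))

instance : CompleteSpace (HardySpace d) :=
  inferInstanceAs (CompleteSpace (lp (fun _ : Fin d → ℕ => ℂ) 2))

/-- The Taylor coefficient of `z ^ α`. -/
def coeff (f : HardySpace d) (α : Fin d → ℕ) : ℂ := (show lp (fun _ : Fin d → ℕ => ℂ) 2 from f) α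

/-- The element with a given square summable family of Taylor coefficients. -/
def ofCoeff (a : (Fin d → ℕ) → ℂ) (ha : Summable fun α => ‖a α‖ ^ 2) : HardySpace d :=
  (⟨a, memℓp_gen (by simpa using ha)⟩ : lp (fun _ : Fin d → ℕ => ℂ) 2)

@[simp] theorem coeff_ofCoeff (a : (Fin d → ℕ) → ℂ) (ha : Summable fun α => ‖a α‖ ^ 2) :
    (ofCoeff a ha).coeff = a := rfl

theorem coeff_add (f g : HardySpace d) (α : Fin d → ℕ) :
    (f + g).coeff α = f.coeff α + g.coeff α := rfl

theorem coeff_smul (c : ℂ) (f : HardySpace d) (α : Fin d → ℕ) :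
    (c • f).coeff α = c * f.coeff α := rfl

/-- The monomial `z ^ α`. -/
def monomial (α : Fin d → ℕ) (z : Fin d → ℂ) : ℂ := ∏ i, z i ^ α i

theorem ext_coeff {f g : HardySpace d} (h : ∀ α, f.coeff α = g.coeff α) : f = g :=
  lp.ext (funext h)

theorem hasSum_inner_coeff (f g : HardySpace d) :
    HasSum (fun α => conj (f.coeff α) * g.coeff α) ⟪f, g⟫_ℂ := by
  have h := lp.hasSum_inner (𝕜 := ℂ) (show lp (fun _ : Fin d → ℕ => ℂ) 2 from f)
    (show lp (fun _ : Fin d → ℕ => ℂ) 2 from g)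
  refine h.congr_fun fun α => ?_
  rw [RCLike.inner_apply, mul_comm]
  rfl

theorem hasSum_norm_sq_coeff (f : HardySpace d) :
    HasSum (fun α => ‖f.coeff α‖ ^ 2) (‖f‖ ^ 2) := by
  have h := lp.hasSum_norm (p := 2) (by norm_num)
    (show lp (fun _ : Fin d → ℕ => ℂ) 2 from f)
  simp only [ENNReal.toReal_ofNat, Real.rpow_ofNat] at h
  exact h

theorem hasSum_mul_of_norm {ι κ : Type*} {f : ι → ℂ} {g : κ → ℂ} {a b : ℂ}
    (hf : Summable fun i => ‖f i‖) (hg : Summable fun k => ‖g k‖) (ha : HasSum f a)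
    (hb : HasSum g b) : HasSum (fun p : ι × κ => f p.1 * g p.2) (a * b) := by
  have h := (summable_mul_of_summable_norm hf hg).hasSum
  rwa [← tsum_mul_tsum_of_summable_norm hf hg, ha.tsum_eq, hb.tsum_eq] at h

theorem norm_prod_geometric {d : ℕ} (w : Fin d → ℂ) (hw : ∀ i, ‖w i‖ < 1) :
    Summable (fun α : Fin d → ℕ => ‖monomial α w‖) ∧
      HasSum (fun α : Fin d → ℕ => monomial α w) (∏ i, (1 - w i)⁻¹) := by
  induction d with
  | zero =>
    refine ⟨(hasSum_fintype (fun α : Fin 0 → ℕ => ‖monomial α w‖)).summable, ?_⟩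
    convert hasSum_fintype (fun α : Fin 0 → ℕ => monomial α w) using 1
    simp [monomial]
  | succ d ih =>
    obtain ⟨h1, h2⟩ := ih (fun i => w i.succ) (fun i => hw _)
    have g1 : Summable (fun n : ℕ => ‖w 0 ^ n‖) := by
      simpa [norm_pow] using summable_geometric_of_lt_one (norm_nonneg _) (hw 0)
    have g2 := hasSum_geometric_of_norm_lt_one (hw 0)
    have key : ∀ p : ℕ × (Fin d → ℕ), monomial (Fin.consEquiv (fun _ => ℕ) p) w =
        w 0 ^ p.1 * monomial p.2 (fun i => w i.succ) := by
      intro p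
      simp [monomial, Fin.prod_univ_succ, Fin.consEquiv]
    constructor
    · rw [← (Fin.consEquiv (fun _ : Fin (d + 1) => ℕ)).summable_iff]
      refine (g1.mul_norm h1).congr fun p => ?_
      rw [Function.comp_apply, key]
    · rw [← (Fin.consEquiv (fun _ : Fin (d + 1) => ℕ)).hasSum_iff, Fin.prod_univ_succ]
      have g3 := hasSum_mul_of_norm g1 h1 g2 h2
      convert g3 using 1
      exact funext key

theorem summable_norm_monomial_sq (z : polydisk d) :
    Summable (fun α : Fin d → ℕ => ‖monomial α z.1‖ ^ 2) := by
  have h := (norm_prod_geometric (fun i => z.1 i ^ 2) (fun i => by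
    rw [norm_pow]; exact pow_lt_one₀ (norm_nonneg _) (z.2 i) two_ne_zero)).1
  refine h.congr fun α => ?_
  simp only [monomial, norm_prod, norm_pow, ← Finset.prod_pow]
  exact Finset.prod_congr rfl fun i _ => by ring

/-- The function `w ↦ ∏ i, (1 - w i * conj (z i))⁻¹`, with coefficients `conj (z ^ α)`. -/
def szego (z : polydisk d) : HardySpace d :=
  ofCoeff (fun α => conj (monomial α z.1)) (by
    simpa using summable_norm_monomial_sq z)

theorem hasSum_inner_szego (z : polydisk d) (f : HardySpace d) :
    HasSum (fun α => f.coeff α * monomial α z.1) ⟪szego z, f⟫_ℂ := by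
  refine (hasSum_inner_coeff (szego z) f).congr_fun fun α => ?_
  simp [szego, mul_comm]

theorem eq_zero_of_hasSum_zero {X E ι : Type*} [TopologicalSpace X] [CompactSpace X]
    [NormedAddCommGroup E] [InnerProductSpace ℂ E] (T : C(X, ℂ) →L[ℂ] E) (e : ι → C(X, ℂ))
    (he : Orthonormal ℂ fun i => T (e i)) {κ : Type*} (j : κ → ι) (hj : Function.Injective j)
    (c : κ → ℂ) (h : HasSum (fun k => c k • e (j k)) 0) (k : κ) : c k = 0 := by
  classical
  have h1 := (h.mapL T).mapL (innerSL ℂ (T (e (j k))))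
  simp only [map_smul, innerSL_apply_apply, orthonormal_iff_ite.mp he, map_zero] at h1
  refine HasSum.unique ?_ h1
  refine (hasSum_ite_eq k (c k)).congr_fun fun l => ?_
  by_cases hl : l = k
  · simp [hl]
  · simp [hl, hj.ne (Ne.symm hl)]

theorem inner_szego_injective (f : HardySpace d) (h : ∀ z : polydisk d, ⟪szego z, f⟫_ℂ = 0) :
    f = 0 := by
  refine ext_coeff fun α => ?_
  have hr : ∀ i : Fin d, ‖(1 / 2 : ℂ)‖ < 1 := fun _ => by norm_num
  let r : polydisk d := ⟨fun _ => 1 / 2, hr⟩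
  let c : (Fin d → ℕ) → ℂ := fun β => f.coeff β * monomial β r.1
  let j : (Fin d → ℕ) → (Fin d → ℤ) := fun β i => β i
  have hj : Function.Injective j := fun a b hab => funext fun i => by
    have := congrFun hab i
    simpa [j] using this
  have hc : Summable fun β => ‖c β • UnitAddTorus.mFourier (j β)‖ := by
    simp only [norm_smul, UnitAddTorus.mFourier_norm, mul_one]
    exact (hasSum_inner_szego r f).summable.norm
  have hsum : HasSum (fun β => c β • UnitAddTorus.mFourier (j β)) 0 := by
    suffices h0 : ∑' β, c β • UnitAddTorus.mFourier (j β) = 0 from h0 ▸ hc.of_norm.hasSum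
    refine (ContinuousMap.ext fun (x : UnitAddTorus (Fin d)) => ?_)
    have hx : ∀ i, ‖(1 / 2 : ℂ) * (fourier 1 (x i) : ℂ)‖ < 1 := fun i => by
      rw [norm_mul, fourier_apply, Circle.norm_coe]; norm_num
    have h1 := hasSum_inner_szego ⟨_, hx⟩ f
    rw [h] at h1
    have h2 := (ContinuousMap.evalCLM ℂ x).hasSum hc.of_norm.hasSum
    refine h2.unique (h1.congr_fun fun β => ?_)
    simp only [ContinuousMap.evalCLM_apply, ContinuousMap.smul_apply, smul_eq_mul, c, monomial,
      UnitAddTorus.mFourier, ContinuousMap.coe_mk, mul_assoc, ← Finset.prod_mul_distrib, r, j]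
    simp [mul_pow, fourier_apply, AddCircle.toCircle_nsmul]
  have h3 : c α = 0 :=
    eq_zero_of_hasSum_zero _ _ (UnitAddTorus.orthonormal_mFourier (d := Fin d)) j hj c hsum α
  have h4 : monomial α r.1 ≠ 0 := by
    simp [monomial, r, Finset.prod_eq_zero_iff]
  exact (mul_eq_zero.mp h3).resolve_right h4

/-- An element `f` of the Hardy space is the function `z ↦ ∑ α, f.coeff α * z ^ α` on the
polydisk. -/
instance : RKHS ℂ (HardySpace d) (polydisk d) ℂ where
  coeCLM := .pi fun z => innerSL ℂ (szego z)
  coeCLM_injective := (injective_iff_map_eq_zero _).mpr fun f hf =>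
    inner_szego_injective f fun z => congrFun hf z

theorem hasSum_apply (f : HardySpace d) (z : polydisk d) :
    HasSum (fun α => f.coeff α * monomial α z.1) (f z) :=
  hasSum_inner_szego z f

/-- The reproducing kernel of `H²(𝔻^d)` is the Szegő kernel. -/
theorem szego_apply (z w : polydisk d) : szego z w = ∏ i, (1 - w.1 i * conj (z.1 i))⁻¹ := by
  refine (hasSum_apply (szego z) w).unique ?_
  refine (norm_prod_geometric (fun i => w.1 i * conj (z.1 i)) fun i => ?_).2.congr_fun fun α => ?_
  · rw [norm_mul, RCLike.norm_conj]
    exact mul_lt_one_of_nonneg_of_lt_one_left (norm_nonneg _) (w.2 i) (z.2 i).le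
  · simp [szego, monomial, mul_pow, Finset.prod_mul_distrib, mul_comm]

/-- The coefficients of `z_j f`: that of `z_j z ^ α` is `f.coeff α`, the others vanish. -/
def shiftCoeff (j : Fin d) (f : HardySpace d) : (Fin d → ℕ) → ℂ :=
  Function.extend (fun α => α + Pi.single j 1) f.coeff 0

theorem shift_injective (j : Fin d) :
    Function.Injective (fun α : Fin d → ℕ => α + Pi.single j 1) := add_left_injective _

theorem shiftCoeff_add_single (j : Fin d) (f : HardySpace d) (α : Fin d → ℕ) :
    shiftCoeff j f (α + Pi.single j 1) = f.coeff α :=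
  (shift_injective j).extend_apply f.coeff 0 α

theorem hasSum_norm_sq_shiftCoeff (j : Fin d) (f : HardySpace d) :
    HasSum (fun α => ‖shiftCoeff j f α‖ ^ 2) (‖f‖ ^ 2) := by
  have h : (fun α => ‖shiftCoeff j f α‖ ^ 2) =
      Function.extend (fun α : Fin d → ℕ => α + Pi.single j 1) (fun α => ‖f.coeff α‖ ^ 2) 0 := by
    funext α
    by_cases hα : ∃ β : Fin d → ℕ, β + Pi.single j 1 = α
    · obtain ⟨β, rfl⟩ := hα
      rw [shiftCoeff_add_single, (shift_injective j).extend_apply]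
    · simp [shiftCoeff, Function.extend_apply' _ _ _ hα]
  rw [h, hasSum_extend_zero (shift_injective j)]
  exact hasSum_norm_sq_coeff f

/-- Multiplication `M_{z_j}` by the coordinate function `z_j`. -/
def mulCoord (j : Fin d) : HardySpace d →L[ℂ] HardySpace d :=
  LinearIsometry.toContinuousLinearMap
    { toFun := fun f => ofCoeff (shiftCoeff j f) (hasSum_norm_sq_shiftCoeff j f).summable
      map_add' := fun f g => ext_coeff fun α => by
        simp only [coeff_add, coeff_ofCoeff]
        by_cases hα : ∃ β : Fin d → ℕ, β + Pi.single j 1 = α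
        · obtain ⟨β, rfl⟩ := hα
          simp only [shiftCoeff_add_single, coeff_add]
        · simp [shiftCoeff, Function.extend_apply' _ _ _ hα]
      map_smul' := fun c f => ext_coeff fun α => by
        simp only [RingHom.id_apply, coeff_smul, coeff_ofCoeff]
        by_cases hα : ∃ β : Fin d → ℕ, β + Pi.single j 1 = α
        · obtain ⟨β, rfl⟩ := hα
          simp only [shiftCoeff_add_single, coeff_smul]
        · simp [shiftCoeff, Function.extend_apply' _ _ _ hα]
      norm_map' := fun f => by
        refine (sq_eq_sq₀ (norm_nonneg _) (norm_nonneg _)).mp ?_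
        exact (hasSum_norm_sq_coeff _).unique (hasSum_norm_sq_shiftCoeff j f) }

theorem mulCoord_apply (j : Fin d) (f : HardySpace d) (z : polydisk d) :
    mulCoord j f z = z.1 j * f z := by
  refine (hasSum_apply (mulCoord j f) z).unique ?_
  have h : (fun α => (mulCoord j f).coeff α * monomial α z.1) =
      Function.extend (fun α : Fin d → ℕ => α + Pi.single j 1)
        (fun α => z.1 j * (f.coeff α * monomial α z.1)) 0 := by
    funext α
    change shiftCoeff j f α * _ = _
    by_cases hα : ∃ β : Fin d → ℕ, β + Pi.single j 1 = α
    · obtain ⟨β, rfl⟩ := hα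
      rw [shiftCoeff_add_single, (shift_injective j).extend_apply]
      have : monomial (β + Pi.single j 1) z.1 = z.1 j * monomial β z.1 := by
        simp only [monomial, Pi.add_apply, pow_add, Finset.prod_mul_distrib]
        rw [mul_comm]
        congr 1
        rw [Finset.prod_eq_single j] <;> simp +contextual
      rw [this]; ring
    · simp [shiftCoeff, Function.extend_apply' _ _ _ hα]
  rw [h, hasSum_extend_zero (shift_injective j)]
  exact (hasSum_apply f z).mul_left _

/-- A closed subspace is a submodule (invariant subspace) if every `M_{z_j}` maps it to itself. -/
def IsInvariant (M : ClosedSubmodule ℂ (HardySpace d)) : Prop :=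
  ∀ j : Fin d, ∀ f ∈ M, mulCoord j f ∈ M

/-- The jumping operator `J_{z_j} : Mᗮ → M`, the upper right corner of the block matrix of
`M_{z_j}` with respect to the decomposition `M ⊕ Mᗮ`. -/
def jump (M : ClosedSubmodule ℂ (HardySpace d)) (j : Fin d) :
    (M.toSubmodule)ᗮ →L[ℂ] M.toSubmodule :=
  M.toSubmodule.orthogonalProjectionOnto ∘L mulCoord j ∘L (M.toSubmodule)ᗮ.subtypeL

/-- The rank of `J_{z_j}` in `ℕ ∪ {∞}`. -/
def jumpRank (M : ClosedSubmodule ℂ (HardySpace d)) (j : Fin d) : ℕ∞ :=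
  (jump M j).toLinearMap.rank.toENat

end HardySpace

end

/-! If `Mᗮ` is finite-dimensional, every operator defined on it has finite rank. Conversely, let all
jumping operators have finite rank. Every `g` in `M` orthogonal to the range of `J_{z_j}` has its
backward shift `bwd j g` again in `M`, because `⟪f, bwd j g⟫ = ⟪z_j f, g⟫ = 0` for `f ∈ Mᗮ`. So, up
to finite dimension, an element of `M` splits inside `M` into a multiple of `z_j` and a part free of
`z_j`. Iterating, each slice in `z_j` maps `M` into its `z_j`-free part, up to finite dimension.

Multiplication by another variable `z_i` preserves `M` and commutes with the slices, so a nonzero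
polynomial `p(z_i)` absorbs the finite-dimensional error (`exists_aeval_slice_mem`). As `p(z_i)`
acts injectively, the variables can be eliminated one by one, until `M` contains a nonzero function
of `z_j` alone. Its slices are constants, so the same absorption puts some `p(z_i) ≠ 0` in `M`. With
such a polynomial for every `i`, the coefficients of any `f ∈ Mᗮ` obey a linear recurrence in each
direction and are determined by those in a finite box. -/

namespace HardySpace

variable {d : ℕ}

/-! ### Monomials, forward and backward shifts -/

/-- The monomial `z ^ α` as an element of the Hardy space. -/
noncomputable def basisVec (α : Fin d → ℕ) : HardySpace d :=
  ofCoeff (Pi.single α 1) (by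
    refine summable_of_ne_finset_zero (s := {α}) fun β hβ => ?_
    have : β ≠ α := by simpa using hβ
    simp [this])

theorem coeff_basisVec (α β : Fin d → ℕ) :
    (basisVec α).coeff β = if β = α then 1 else 0 := by
  simp [basisVec, Pi.single_apply]

theorem inner_basisVec (α : Fin d → ℕ) (f : HardySpace d) : ⟪basisVec α, f⟫_ℂ = f.coeff α := by
  refine (hasSum_inner_coeff (basisVec α) f).unique ?_
  convert hasSum_ite_eq α (f.coeff α) using 2 with β
  rw [coeff_basisVec]
  split_ifs with h <;> simp [h]

theorem coeff_zero (α : Fin d → ℕ) : (0 : HardySpace d).coeff α = 0 := rfl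

theorem coeff_sub (f g : HardySpace d) (α : Fin d → ℕ) :
    (f - g).coeff α = f.coeff α - g.coeff α := rfl

theorem coeff_mulCoord_add_single (j : Fin d) (f : HardySpace d) (α : Fin d → ℕ) :
    (mulCoord j f).coeff (α + Pi.single j 1) = f.coeff α :=
  shiftCoeff_add_single j f α

theorem coeff_mulCoord_of_eq_zero (j : Fin d) (f : HardySpace d) {α : Fin d → ℕ} (h : α j = 0) :
    (mulCoord j f).coeff α = 0 := by
  refine Function.extend_apply' _ _ _ ?_
  rintro ⟨β, rfl⟩
  simp at h

theorem exists_eq_add_single_of_le {j : Fin d} {α : Fin d → ℕ} {n : ℕ} (h : n ≤ α j) :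
    ∃ β : Fin d → ℕ, α = β + Pi.single j n := by
  refine ⟨α - Pi.single j n, funext fun i => ?_⟩
  rw [Pi.add_apply, Pi.sub_apply]
  by_cases hi : i = j
  · subst hi
    rw [Pi.single_eq_same]
    omega
  · rw [Pi.single_eq_of_ne hi]
    omega

theorem exists_eq_add_single {j : Fin d} {α : Fin d → ℕ} (h : α j ≠ 0) :
    ∃ β : Fin d → ℕ, α = β + Pi.single j 1 :=
  exists_eq_add_single_of_le (Nat.one_le_iff_ne_zero.mpr h)

theorem mulCoord_basisVec (j : Fin d) (α : Fin d → ℕ) :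
    mulCoord j (basisVec α) = basisVec (α + Pi.single j 1) := by
  refine ext_coeff fun β => ?_
  by_cases hβ : β j = 0
  · rw [coeff_mulCoord_of_eq_zero j _ hβ, coeff_basisVec, if_neg]
    rintro rfl
    simp at hβ
  · obtain ⟨γ, rfl⟩ := exists_eq_add_single hβ
    rw [coeff_mulCoord_add_single, coeff_basisVec, coeff_basisVec]
    simp

/-- Multiplication by `z_j` as a linear endomorphism. -/
noncomputable def fwd (j : Fin d) : Module.End ℂ (HardySpace d) := (mulCoord j).toLinearMap

/-- The backward shift in the variable `z_j`. -/
noncomputable def bwd (j : Fin d) : Module.End ℂ (HardySpace d) :=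
  (ContinuousLinearMap.adjoint (mulCoord j)).toLinearMap

theorem inner_fwd (j : Fin d) (f g : HardySpace d) : ⟪fwd j f, g⟫_ℂ = ⟪f, bwd j g⟫_ℂ :=
  (ContinuousLinearMap.adjoint_inner_right (mulCoord j) f g).symm

theorem coeff_fwd_add_single (j : Fin d) (f : HardySpace d) (α : Fin d → ℕ) :
    (fwd j f).coeff (α + Pi.single j 1) = f.coeff α :=
  coeff_mulCoord_add_single j f α

theorem coeff_fwd_of_eq_zero (j : Fin d) (f : HardySpace d) {α : Fin d → ℕ} (h : α j = 0) :
    (fwd j f).coeff α = 0 :=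
  coeff_mulCoord_of_eq_zero j f h

theorem fwd_basisVec (j : Fin d) (α : Fin d → ℕ) :
    fwd j (basisVec α) = basisVec (α + Pi.single j 1) :=
  mulCoord_basisVec j α

theorem coeff_bwd (j : Fin d) (f : HardySpace d) (α : Fin d → ℕ) :
    (bwd j f).coeff α = f.coeff (α + Pi.single j 1) := by
  rw [← inner_basisVec, ← inner_fwd, fwd_basisVec, inner_basisVec]

theorem coeff_bwd_pow (j : Fin d) (f : HardySpace d) (m : ℕ) (α : Fin d → ℕ) :
    ((bwd j ^ m) f).coeff α = f.coeff (α + Pi.single j m) := by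
  induction m generalizing f with
  | zero => simp
  | succ m ih =>
    rw [pow_succ, Module.End.mul_apply, ih, coeff_bwd, add_assoc, ← Pi.single_add]

theorem bwd_mul_fwd (j : Fin d) : bwd j * fwd j = 1 := by
  ext1 f
  refine ext_coeff fun α => ?_
  rw [Module.End.mul_apply, coeff_bwd, coeff_fwd_add_single, Module.End.one_apply]

theorem bwd_fwd (j : Fin d) (f : HardySpace d) : bwd j (fwd j f) = f :=
  LinearMap.congr_fun (bwd_mul_fwd j) f

theorem commute_bwd_bwd (i j : Fin d) : Commute (bwd i) (bwd j) := by
  ext1 f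
  refine ext_coeff fun α => ?_
  simp only [Module.End.mul_apply, coeff_bwd]
  rw [add_right_comm]

theorem commute_fwd_bwd {i j : Fin d} (h : i ≠ j) : Commute (fwd i) (bwd j) := by
  ext1 f
  refine ext_coeff fun α => ?_
  simp only [Module.End.mul_apply, coeff_bwd]
  by_cases hα : α i = 0
  · rw [coeff_fwd_of_eq_zero _ _ hα, coeff_fwd_of_eq_zero _ _ (by simp [hα, h])]
  · obtain ⟨γ, rfl⟩ := exists_eq_add_single hα
    rw [coeff_fwd_add_single, add_right_comm, coeff_fwd_add_single, coeff_bwd]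

theorem commute_fwd_fwd (i j : Fin d) : Commute (fwd i) (fwd j) := by
  ext1 f
  refine ext_inner_right ℂ fun g => ?_
  simp only [Module.End.mul_apply, inner_fwd]
  rw [← Module.End.mul_apply, (commute_bwd_bwd j i).eq, Module.End.mul_apply]

/-! ### Slices in one variable -/

/-- The coefficient of `z_j ^ m` in the expansion of `f` in powers of `z_j`, a function of the
other variables. -/
noncomputable def slice (j : Fin d) (m : ℕ) : Module.End ℂ (HardySpace d) :=
  (1 - fwd j * bwd j) * bwd j ^ m

theorem slice_apply (j : Fin d) (m : ℕ) (f : HardySpace d) :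
    slice j m f = (bwd j ^ m) f - fwd j (bwd j ((bwd j ^ m) f)) := rfl

theorem coeff_slice (j : Fin d) (m : ℕ) (f : HardySpace d) {α : Fin d → ℕ} (h : α j = 0) :
    (slice j m f).coeff α = f.coeff (α + Pi.single j m) := by
  rw [slice_apply, coeff_sub, coeff_fwd_of_eq_zero _ _ h, coeff_bwd_pow, sub_zero]

theorem eq_zero_of_slice_eq_zero (j : Fin d) (f : HardySpace d) (h : ∀ m, slice j m f = 0) :
    f = 0 := by
  refine ext_coeff fun α => ?_
  have h1 := coeff_slice j (α j) f (α := Function.update α j 0) (by simp)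
  have h2 : Function.update α j 0 + Pi.single j (α j) = α := by
    funext i
    by_cases hi : i = j
    · subst hi; simp
    · simp [hi]
  rw [h, h2] at h1
  exact h1.symm

theorem slice_zero_fwd (j : Fin d) (f : HardySpace d) : slice j 0 (fwd j f) = 0 := by
  simp [slice_apply, bwd_fwd]

theorem slice_succ_fwd (j : Fin d) (m : ℕ) (f : HardySpace d) :
    slice j (m + 1) (fwd j f) = slice j m f := by
  simp [slice_apply, pow_succ, bwd_fwd]

theorem slice_zero_of_bwd_eq_zero (j : Fin d) {f : HardySpace d} (h : bwd j f = 0) :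
    slice j 0 f = f := by
  simp [slice_apply, h]

theorem slice_succ_of_bwd_eq_zero (j : Fin d) (m : ℕ) {f : HardySpace d} (h : bwd j f = 0) :
    slice j (m + 1) f = 0 := by
  simp [slice_apply, pow_succ, h]

theorem commute_fwd_slice {i j : Fin d} (h : i ≠ j) (m : ℕ) : Commute (fwd i) (slice j m) :=
  ((Commute.one_right _).sub_right
    ((commute_fwd_fwd i j).mul_right (commute_fwd_bwd h))).mul_right
    ((commute_fwd_bwd h).pow_right m)

/-! ### Injectivity of multiplication by a polynomial in one variable -/

theorem commute_aeval {A : Type*} [Ring A] [Algebra ℂ A] {a b : A} (h : Commute a b)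
    (p : Polynomial ℂ) : Commute (Polynomial.aeval a p) b := by
  rw [Polynomial.aeval_eq_sum_range]
  exact Commute.sum_left _ _ _ fun k _ => (h.pow_left k).smul_left _

/-- The shift has no eigenvalues: for `c ≠ 0` the coefficients vanish successively, by induction on
the exponent of `z_i`. -/
theorem fwd_eq_smul (i : Fin d) (c : ℂ) {f : HardySpace d} (h : fwd i f = c • f) : f = 0 := by
  by_cases hc : c = 0
  · rw [← bwd_fwd i f, h, hc, zero_smul, map_zero]
  · refine ext_coeff fun α => ?_
    induction hn : α i generalizing α with
    | zero =>
      have h1 := coeff_fwd_of_eq_zero i f hn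
      rw [h, coeff_smul] at h1
      exact (mul_eq_zero.mp h1).resolve_left hc
    | succ n ih =>
      obtain ⟨β, rfl⟩ := exists_eq_add_single (j := i) (α := α) (by omega)
      have h1 := coeff_fwd_add_single i f β
      rw [h, coeff_smul, ih β (by simpa using hn)] at h1
      exact (mul_eq_zero.mp h1).resolve_left hc

/-- Over `ℂ` the polynomial splits into linear factors, each injective because the shift has no
eigenvalues. -/
theorem eq_zero_of_aeval_fwd (i : Fin d) {p : Polynomial ℂ} (hp : p ≠ 0) {f : HardySpace d}
    (h : Polynomial.aeval (fwd i) p f = 0) : f = 0 := by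
  induction hn : p.natDegree generalizing p f with
  | zero =>
    obtain ⟨c, rfl⟩ := Polynomial.natDegree_eq_zero.mp hn
    have hc : c ≠ 0 := by simpa using hp
    rw [Polynomial.aeval_C, Module.algebraMap_end_apply] at h
    exact (smul_eq_zero.mp h).resolve_left hc
  | succ n ih =>
    obtain ⟨c, hc⟩ := IsAlgClosed.exists_root p (by
      rw [Polynomial.degree_eq_natDegree hp, hn]; exact_mod_cast n.succ_ne_zero)
    obtain ⟨q, rfl⟩ := Polynomial.dvd_iff_isRoot.mpr hc
    have hq : q ≠ 0 := right_ne_zero_of_mul hp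
    have hd : q.natDegree = n := by
      rw [Polynomial.natDegree_mul (Polynomial.X_sub_C_ne_zero c) hq,
        Polynomial.natDegree_X_sub_C] at hn
      omega
    refine ih hq (fwd_eq_smul i c ?_) hd
    rw [map_mul, Module.End.mul_apply] at h
    simpa [sub_eq_zero] using h

/-! ### Linear algebra modulo finite dimension -/

/-- A complement in `V` of the kernel of `φ` restricted to `V` embeds in `E'`, hence is
finite-dimensional. -/
theorem exists_le_inf_ker_sup {E E' : Type*} [AddCommGroup E] [Module ℂ E] [AddCommGroup E']
    [Module ℂ E'] (φ : E →ₗ[ℂ] E') [FiniteDimensional ℂ E'] (V : Submodule ℂ E) :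
    ∃ F : Submodule ℂ E, FiniteDimensional ℂ F ∧ V ≤ (V ⊓ LinearMap.ker φ) ⊔ F := by
  obtain ⟨C, hC⟩ := Submodule.exists_isCompl (LinearMap.ker (φ.domRestrict V))
  have hfin : FiniteDimensional ℂ C := by
    refine FiniteDimensional.of_injective ((φ.domRestrict V).domRestrict C) ?_
    rw [← LinearMap.ker_eq_bot, LinearMap.ker_domRestrict, ← Submodule.disjoint_iff_comap_eq_bot]
    exact hC.symm.disjoint
  refine ⟨C.map V.subtype, inferInstance, fun x hx => ?_⟩
  obtain ⟨y, hy, z, hz, hyz⟩ := Submodule.mem_sup.mp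
    (hC.sup_eq_top ▸ Submodule.mem_top : (⟨x, hx⟩ : V) ∈ LinearMap.ker (φ.domRestrict V) ⊔ C)
  exact Submodule.mem_sup.mpr ⟨y, ⟨y.2, hy⟩, z, ⟨z, hz, rfl⟩, congrArg Subtype.val hyz⟩

/-- The orbit of `g` stays in `V`, whose image modulo `U` lies in that of `F`; since `ℂ[X]` is
infinite-dimensional, `p ↦ p(T) g` modulo `U` has a nonzero kernel. -/
theorem exists_aeval_mem {E : Type*} [AddCommGroup E] [Module ℂ E] (T : Module.End ℂ E)
    {V U F : Submodule ℂ E} [FiniteDimensional ℂ F] (hV : V ≤ U ⊔ F) (hT : ∀ v ∈ V, T v ∈ V)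
    {g : E} (hg : g ∈ V) : ∃ p : Polynomial ℂ, p ≠ 0 ∧ Polynomial.aeval T p g ∈ U := by
  have hmem : ∀ p : Polynomial ℂ, Polynomial.aeval T p g ∈ V := fun p => by
    induction p using Polynomial.induction_on' with
    | add p q hp hq => rw [map_add, LinearMap.add_apply]; exact V.add_mem hp hq
    | monomial n a =>
      rw [Polynomial.aeval_monomial, Module.End.mul_apply, Module.algebraMap_end_apply]
      refine V.smul_mem a ?_
      induction n with
      | zero => simpa using hg
      | succ n ih => rw [pow_succ', Module.End.mul_apply]; exact hT _ ih
  let ψ : Polynomial ℂ →ₗ[ℂ] E ⧸ U :=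
    U.mkQ ∘ₗ LinearMap.applyₗ g ∘ₗ (Polynomial.aeval T).toLinearMap
  have hψ : ∀ p, ψ p ∈ F.map U.mkQ := fun p => by
    obtain ⟨u, hu, x, hx, h⟩ := Submodule.mem_sup.mp (hV (hmem p))
    refine ⟨x, hx, ?_⟩
    have h1 : ψ p = U.mkQ (Polynomial.aeval T p g) := rfl
    rw [h1, ← h, map_add]
    simp [hu]
  have hinj : ¬ Function.Injective (ψ.codRestrict _ hψ) := fun h =>
    Polynomial.not_finite (R := ℂ) (FiniteDimensional.of_injective _ h)
  rw [← LinearMap.ker_eq_bot, LinearMap.ker_codRestrict, Submodule.eq_bot_iff] at hinj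
  push Not at hinj
  obtain ⟨p, hp, hp0⟩ := hinj
  exact ⟨p, hp0, by simpa [ψ] using hp⟩

/-! ### Eliminating variables when the jumping operators have finite rank -/

/-- The elements of `M` that depend only on the variables `z_k`, `k ∈ A`. -/
noncomputable def partIn (M : Submodule ℂ (HardySpace d)) (A : Finset (Fin d)) :
    Submodule ℂ (HardySpace d) :=
  M ⊓ ⨅ k ∈ Aᶜ, LinearMap.ker (bwd k)

theorem mem_partIn {M : Submodule ℂ (HardySpace d)} {A : Finset (Fin d)} {f : HardySpace d} :
    f ∈ partIn M A ↔ f ∈ M ∧ ∀ k, k ∉ A → bwd k f = 0 := by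
  simp [partIn, Submodule.mem_iInf]

theorem partIn_mono (M : Submodule ℂ (HardySpace d)) {A B : Finset (Fin d)} (h : A ⊆ B) :
    partIn M A ≤ partIn M B := fun f hf => by
  rw [mem_partIn] at hf ⊢
  exact ⟨hf.1, fun k hk => hf.2 k fun hA => hk (h hA)⟩

theorem fwd_mem_partIn {M : Submodule ℂ (HardySpace d)} {A : Finset (Fin d)} {j : Fin d}
    (hM : ∀ f ∈ M, fwd j f ∈ M) (hj : j ∈ A) {f : HardySpace d} (hf : f ∈ partIn M A) :
    fwd j f ∈ partIn M A := by
  rw [mem_partIn] at hf ⊢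
  refine ⟨hM f hf.1, fun k hk => ?_⟩
  have hjk : j ≠ k := fun h => hk (h ▸ hj)
  have := LinearMap.congr_fun (commute_fwd_bwd hjk).eq f
  simp only [Module.End.mul_apply] at this
  rw [← this, hf.2 k hk, map_zero]

theorem mem_sup_of_bwd_mem {M : Submodule ℂ (HardySpace d)} {A : Finset (Fin d)} {j : Fin d}
    (hM : ∀ f ∈ M, fwd j f ∈ M) {f : HardySpace d} (hf : f ∈ partIn M A) (hb : bwd j f ∈ M) :
    f ∈ (partIn M A).map (fwd j) ⊔ partIn M (A.erase j) := by
  have hf' := mem_partIn.mp hf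
  have hcomm : ∀ k, bwd k (bwd j f) = bwd j (bwd k f) := fun k =>
    LinearMap.congr_fun (commute_bwd_bwd k j).eq f
  refine Submodule.mem_sup.mpr ⟨fwd j (bwd j f), ⟨bwd j f, mem_partIn.mpr ⟨hb, fun k hk => ?_⟩, rfl⟩,
    f - fwd j (bwd j f), mem_partIn.mpr ⟨M.sub_mem hf'.1 (hM _ hb), fun k hk => ?_⟩, by simp⟩
  · rw [hcomm, hf'.2 k hk, map_zero]
  · by_cases hkj : k = j
    · subst hkj
      rw [map_sub, bwd_fwd, sub_self]
    · have hkA : k ∉ A := fun h => hk (Finset.mem_erase.mpr ⟨hkj, h⟩)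
      have := LinearMap.congr_fun (commute_fwd_bwd (Ne.symm hkj)).eq (bwd j f)
      simp only [Module.End.mul_apply] at this
      rw [map_sub, ← this, hcomm, hf'.2 k hkA, map_zero, map_zero, sub_zero]

theorem bwd_mem_of_mem_orthogonal_range (M : ClosedSubmodule ℂ (HardySpace d)) (j : Fin d)
    {g : HardySpace d} (hg : g ∈ M)
    (h : M.toSubmodule.orthogonalProjectionOnto g ∈ (LinearMap.range (jump M j).toLinearMap)ᗮ) :
    bwd j g ∈ M.toSubmodule := by
  rw [← Submodule.orthogonal_orthogonal M.toSubmodule, Submodule.mem_orthogonal]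
  intro f hf
  have h1 := (Submodule.mem_orthogonal _ _).mp h _ ⟨⟨f, hf⟩, rfl⟩
  have h2 : (jump M j).toLinearMap ⟨f, hf⟩ =
    M.toSubmodule.orthogonalProjectionOnto (fwd j f) := rfl
  rw [h2, Submodule.inner_orthogonalProjectionOnto_eq_of_mem_right,
    Submodule.orthogonalProjectionOnto_mem_subspace_eq_self ⟨g, hg⟩] at h1
  rwa [inner_fwd] at h1

theorem exists_partIn_le (M : ClosedSubmodule ℂ (HardySpace d)) (hinv : IsInvariant M)
    (j : Fin d) [FiniteDimensional ℂ (LinearMap.range (jump M j).toLinearMap)]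
    (A : Finset (Fin d)) :
    ∃ F : Submodule ℂ (HardySpace d), FiniteDimensional ℂ F ∧
      partIn M.toSubmodule A ≤ ((partIn M.toSubmodule A).map (fwd j) ⊔
        partIn M.toSubmodule (A.erase j)) ⊔ F := by
  let R := LinearMap.range (jump M j).toLinearMap
  obtain ⟨F, hF, hle⟩ := exists_le_inf_ker_sup
    -- The kernel of this map cuts out the elements orthogonal to the range of `J_{z_j}`; its target
    -- `R` is finite-dimensional by hypothesis.
    (R.orthogonalProjectionOnto ∘L M.toSubmodule.orthogonalProjectionOnto).toLinearMap
    (partIn M.toSubmodule A)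
  refine ⟨F, hF, hle.trans (sup_le_sup_right (fun f hf => ?_) F)⟩
  have hfM : f ∈ M := (mem_partIn.mp hf.1).1
  refine mem_sup_of_bwd_mem (fun f hf => hinv j f hf) hf.1
    (bwd_mem_of_mem_orthogonal_range M j hfM ?_)
  exact (Submodule.orthogonalProjectionOnto_eq_zero_iff).mp hf.2

/-- Slice `m + 1` of `z_j f` is slice `m` of `f`, while elements of `L` have only slice `0`. Each
step enlarges the error space from `F'` to `z_j F' + F`. -/
theorem exists_le_comap_slice {V L F : Submodule ℂ (HardySpace d)} [FiniteDimensional ℂ F]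
    {j : Fin d} (hL : ∀ f ∈ L, bwd j f = 0) (h : V ≤ (V.map (fwd j) ⊔ L) ⊔ F) (m : ℕ) :
    ∃ F' : Submodule ℂ (HardySpace d), FiniteDimensional ℂ F' ∧
      V ≤ L.comap (slice j m) ⊔ F' := by
  induction m with
  | zero =>
    refine ⟨F, inferInstance, h.trans (sup_le_sup_right (sup_le ?_ fun f hf => ?_) F)⟩
    · rintro _ ⟨f, -, rfl⟩
      rw [Submodule.mem_comap, slice_zero_fwd]
      exact L.zero_mem
    · rw [Submodule.mem_comap, slice_zero_of_bwd_eq_zero j (hL f hf)]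
      exact hf
  | succ m ih =>
    obtain ⟨F', hF', hle⟩ := ih
    refine ⟨F'.map (fwd j) ⊔ F, inferInstance, h.trans ?_⟩
    rw [← sup_assoc]
    refine sup_le_sup_right (sup_le ?_ fun f hf => ?_) F
    · refine (Submodule.map_mono hle).trans ?_
      rw [Submodule.map_sup]
      refine sup_le_sup_right ?_ _
      rintro _ ⟨f, hf, rfl⟩
      rw [Submodule.mem_comap, slice_succ_fwd]
      exact hf
    · refine Submodule.mem_sup_left ?_
      rw [Submodule.mem_comap, slice_succ_of_bwd_eq_zero j m (hL f hf)]
      exact L.zero_mem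

theorem exists_aeval_slice_mem (M : ClosedSubmodule ℂ (HardySpace d)) (hinv : IsInvariant M)
    {i j : Fin d} [FiniteDimensional ℂ (LinearMap.range (jump M j).toLinearMap)] (hij : i ≠ j)
    {A : Finset (Fin d)} (hi : i ∈ A) {g : HardySpace d} (hg : g ∈ partIn M.toSubmodule A)
    (m : ℕ) : ∃ p : Polynomial ℂ, p ≠ 0 ∧
      Polynomial.aeval (fwd i) p (slice j m g) ∈ partIn M.toSubmodule (A.erase j) := by
  obtain ⟨F, hF, hle⟩ := exists_partIn_le M hinv j A
  obtain ⟨F', hF', hle'⟩ := exists_le_comap_slice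
    (fun f hf => (mem_partIn.mp hf).2 j (Finset.notMem_erase j A)) hle m
  obtain ⟨p, hp, hmem⟩ := exists_aeval_mem (fwd i) hle'
    (fun v hv => fwd_mem_partIn (fun f hf => hinv i f hf) hi hv) hg
  refine ⟨p, hp, ?_⟩
  rwa [Submodule.mem_comap, ← Module.End.mul_apply,
    ← (commute_aeval (commute_fwd_slice hij m) p).eq] at hmem

theorem partIn_erase_ne_bot (M : ClosedSubmodule ℂ (HardySpace d)) (hinv : IsInvariant M)
    {i j : Fin d} [FiniteDimensional ℂ (LinearMap.range (jump M j).toLinearMap)] (hij : i ≠ j)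
    {A : Finset (Fin d)} (hi : i ∈ A) (hA : partIn M.toSubmodule A ≠ ⊥) :
    partIn M.toSubmodule (A.erase j) ≠ ⊥ := by
  intro hbot
  refine hA ((Submodule.eq_bot_iff _).mpr fun g hg => eq_zero_of_slice_eq_zero j g fun m => ?_)
  obtain ⟨p, hp, hmem⟩ := exists_aeval_slice_mem M hinv hij hi hg m
  rw [hbot, Submodule.mem_bot] at hmem
  exact eq_zero_of_aeval_fwd i hp hmem

theorem partIn_sdiff_ne_bot (M : ClosedSubmodule ℂ (HardySpace d)) (hM : M ≠ ⊥)
    (hinv : IsInvariant M)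
    (hfin : ∀ j, FiniteDimensional ℂ (LinearMap.range (jump M j).toLinearMap)) (i : Fin d)
    (s : Finset (Fin d)) (hs : i ∉ s) : partIn M.toSubmodule sᶜ ≠ ⊥ := by
  induction s using Finset.induction_on with
  | empty =>
    intro h
    refine hM (ClosedSubmodule.toSubmodule_injective ?_)
    have : partIn M.toSubmodule (∅ : Finset (Fin d))ᶜ = M.toSubmodule := by simp [partIn]
    rw [this] at h
    exact h
  | insert j s hj ih =>
    rw [Finset.mem_insert, not_or] at hs
    rw [Finset.compl_insert]
    have := hfin j
    exact partIn_erase_ne_bot M hinv hs.1 (Finset.mem_compl.mpr hs.2) (ih hs.2)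

/-! ### One-variable polynomials in the submodule -/

theorem slice_eq_smul_basisVec {M : Submodule ℂ (HardySpace d)} {j : Fin d} {g : HardySpace d}
    (hg : g ∈ partIn M {j}) (m : ℕ) :
    slice j m g = (slice j m g).coeff 0 • basisVec 0 := by
  refine ext_coeff fun α => ?_
  rw [coeff_smul, coeff_basisVec]
  split_ifs with hα
  · rw [hα, mul_one]
  rw [mul_zero]
  by_cases hj : α j = 0
  · obtain ⟨k, hk⟩ : ∃ k, α k ≠ 0 := by
      by_contra! h
      exact hα (funext h)
    obtain ⟨β, rfl⟩ := exists_eq_add_single hk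
    have hkj : k ≠ j := fun h => hk (h ▸ hj)
    rw [coeff_slice j m g hj, add_right_comm, ← coeff_bwd,
      (mem_partIn.mp hg).2 k (by simpa using hkj), coeff_zero]
  · obtain ⟨β, rfl⟩ := exists_eq_add_single hj
    rw [← coeff_bwd, slice_apply, map_sub, bwd_fwd, sub_self, coeff_zero]

theorem exists_aeval_basisVec_zero_mem (hd : 2 ≤ d) (M : ClosedSubmodule ℂ (HardySpace d))
    (hM : M ≠ ⊥) (hinv : IsInvariant M)
    (hfin : ∀ j, FiniteDimensional ℂ (LinearMap.range (jump M j).toLinearMap)) (i : Fin d) :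
    ∃ p : Polynomial ℂ, p ≠ 0 ∧ Polynomial.aeval (fwd i) p (basisVec 0) ∈ M.toSubmodule := by
  have : Nontrivial (Fin d) := Fin.nontrivial_iff_two_le.mpr hd
  obtain ⟨j, hji⟩ := exists_ne i
  -- Every variable except `z_j` is eliminated.
  have hne := partIn_sdiff_ne_bot M hM hinv hfin j {j}ᶜ (by simp)
  rw [compl_compl] at hne
  obtain ⟨g, hg, hg0⟩ := Submodule.exists_mem_ne_zero_of_ne_bot hne
  obtain ⟨m, hm⟩ : ∃ m, slice j m g ≠ 0 := by
    by_contra! h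
    exact hg0 (eq_zero_of_slice_eq_zero j g h)
  have := hfin j
  -- Although `g` involves only `z_j`, it is viewed in the variables `z_i, z_j`, to leave room for
  -- multiplication by `z_i`.
  obtain ⟨p, hp, hmem⟩ := exists_aeval_slice_mem M hinv hji.symm (A := {i, j}) (by simp)
    (partIn_mono _ (by simp) hg) m
  have hs := slice_eq_smul_basisVec hg m
  have hc : (slice j m g).coeff 0 ≠ 0 := fun h => hm (by rw [hs, h, zero_smul])
  refine ⟨p, hp, ?_⟩
  rw [hs, map_smul] at hmem
  exact (Submodule.smul_mem_iff _ hc).mp (mem_partIn.mp hmem).1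

/-! ### Finite-dimensionality of the orthogonal complement -/

theorem aeval_basisVec_mem (M : ClosedSubmodule ℂ (HardySpace d)) (hinv : IsInvariant M)
    {i : Fin d} {p : Polynomial ℂ}
    (h : Polynomial.aeval (fwd i) p (basisVec 0) ∈ M.toSubmodule) (γ : Fin d → ℕ) :
    Polynomial.aeval (fwd i) p (basisVec γ) ∈ M.toSubmodule := by
  induction hn : ∑ k, γ k generalizing γ with
  | zero =>
    have : γ = 0 := funext fun k => by simpa using (Finset.sum_eq_zero_iff.mp hn) k
    rwa [this]
  | succ n ih =>
    obtain ⟨k, hk⟩ : ∃ k, γ k ≠ 0 := by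
      by_contra! h0
      simp [h0] at hn
    obtain ⟨β, rfl⟩ := exists_eq_add_single hk
    have h1 : ∑ k, β k = n := by
      simpa [Finset.sum_add_distrib] using hn
    have h2 := LinearMap.congr_fun (commute_aeval (commute_fwd_fwd i k) p).eq (basisVec β)
    simp only [Module.End.mul_apply, fwd_basisVec] at h2
    rw [h2]
    exact hinv k _ (ih β h1)

theorem fwd_pow_basisVec (i : Fin d) (k : ℕ) (γ : Fin d → ℕ) :
    (fwd i ^ k) (basisVec γ) = basisVec (γ + Pi.single i k) := by
  induction k with
  | zero => simp
  | succ k ih =>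
    rw [pow_succ', Module.End.mul_apply, ih, fwd_basisVec, add_assoc, ← Pi.single_add]

/-- The recurrence is orthogonality of `f` to `z^γ p(z_i)`. -/
theorem sum_coeff_eq_zero {M : Submodule ℂ (HardySpace d)} {i : Fin d} {p : Polynomial ℂ}
    {γ : Fin d → ℕ} (h : Polynomial.aeval (fwd i) p (basisVec γ) ∈ M) {f : HardySpace d}
    (hf : f ∈ Mᗮ) :
    ∑ k ∈ Finset.range (p.natDegree + 1), conj (p.coeff k) * f.coeff (γ + Pi.single i k) = 0 := by
  have h1 := (Submodule.mem_orthogonal _ _).mp hf _ h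
  rw [Polynomial.aeval_eq_sum_range, LinearMap.sum_apply, sum_inner] at h1
  simpa only [LinearMap.smul_apply, fwd_pow_basisVec, inner_smul_left, inner_basisVec] using h1

theorem finiteDimensional_orthogonal (M : ClosedSubmodule ℂ (HardySpace d)) (hinv : IsInvariant M)
    (h : ∀ i, ∃ p : Polynomial ℂ, p ≠ 0 ∧
      Polynomial.aeval (fwd i) p (basisVec 0) ∈ M.toSubmodule) :
    FiniteDimensional ℂ (M.toSubmodule)ᗮ := by
  choose p hp hmem using h
  -- Record only the coefficients whose exponent in each `z_i` is below the degree of `p i`.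
  let φ : (M.toSubmodule)ᗮ →ₗ[ℂ] (((i : Fin d) → Fin (p i).natDegree) → ℂ) :=
    { toFun := fun f β => f.1.coeff fun i => β i
      map_add' := fun f g => rfl
      map_smul' := fun c f => rfl }
  refine FiniteDimensional.of_injective φ ((injective_iff_map_eq_zero φ).mpr fun f hf => ?_)
  refine Subtype.ext (ext_coeff fun α => ?_)
  rw [Submodule.coe_zero, coeff_zero]
  induction hn : ∑ k, α k using Nat.strong_induction_on generalizing α with
  | _ n ih =>
    by_cases hα : ∀ i, α i < (p i).natDegree
    · exact congrFun hf fun i => ⟨α i, hα i⟩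
    push Not at hα
    obtain ⟨i, hi⟩ := hα
    obtain ⟨γ, rfl⟩ := exists_eq_add_single_of_le hi
    have h1 := sum_coeff_eq_zero (aeval_basisVec_mem M hinv (hmem i) γ) f.2
    rw [Finset.sum_range_succ, Finset.sum_eq_zero, zero_add] at h1
    -- The other terms of the recurrence have smaller total degree, so only the leading one remains,
    -- and the leading coefficient of `p i` is nonzero.
    · refine (mul_eq_zero.mp h1).resolve_left ?_
      simpa using hp i
    · intro k hk
      rw [ih _ ?_ _ rfl, mul_zero]
      rw [← hn]
      simpa [Finset.sum_add_distrib] using hk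

/-! ### Ranks, codimension and the theorem -/

theorem jumpRank_ne_top_iff (M : ClosedSubmodule ℂ (HardySpace d)) (j : Fin d) :
    jumpRank M j ≠ ⊤ ↔ FiniteDimensional ℂ (LinearMap.range (jump M j).toLinearMap) := by
  rw [jumpRank, Ne, Cardinal.toENat_eq_top, not_le, LinearMap.rank, Module.rank_lt_aleph0_iff]

theorem finiteDimensional_quotient_iff (M : ClosedSubmodule ℂ (HardySpace d)) :
    FiniteDimensional ℂ (HardySpace d ⧸ M.toSubmodule) ↔
      FiniteDimensional ℂ (M.toSubmodule)ᗮ :=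
  Module.Finite.equiv_iff
    (Submodule.quotientEquivOfIsCompl _ _ M.toSubmodule.isCompl_orthogonal)

end HardySpace

theorem theorem3 {d : ℕ} (hd : 2 ≤ d) (M : ClosedSubmodule ℂ (HardySpace d))
    (hM : M ≠ ⊥) (hinv : HardySpace.IsInvariant M) :
    ¬ FiniteDimensional ℂ (HardySpace d ⧸ M.toSubmodule) ↔
      ∑ j : Fin d, HardySpace.jumpRank M j = ⊤ := by
  have hsum : ∑ j, HardySpace.jumpRank M j ≠ ⊤ ↔ ∀ j ∈ Finset.univ, HardySpace.jumpRank M j ≠ ⊤ :=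
    WithTop.sum_ne_top
  rw [← not_iff_not, not_not, HardySpace.finiteDimensional_quotient_iff, ← Ne, hsum]
  simp only [Finset.mem_univ, forall_const, HardySpace.jumpRank_ne_top_iff]
  exact ⟨fun _ _ => inferInstance, fun hfin => HardySpace.finiteDimensional_orthogonal M hinv
    (HardySpace.exists_aeval_basisVec_zero_mem hd M hM hinv hfin)⟩
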